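/- For $N\ge 1$ items and $p\in(0,1)$, let $X=(x_1,\dots,x_N)\in\{0,1\}^N$ have the Bernoulli product law $\mu_p(X)=\prod_{i=1}^N p^{x_i}(1-p)^{1-x_i}$, where $x_i=1$ means that item $i$ is defective. A two-stage algorithm is given by a number $M\in\{1,\dots,N\}$ of first-stage tests and a matrix $C=(c_{i,a})\in\{0,1\}^{N\times M}$, where $c_{i,a}=1$ means that item $i$ belongs to pool $a$; test $a$ is positive if pool $a$ contains a defective item, and negative otherwise. An item is a sure zero if it belongs to some pool whose test is negative; it is a sure one if it belongs to some pool whose test is positive and all of whose other members are sure zeros. Let $\mathcal U_0$ be the set of non-defective items that are not sure zeros and $\mathcal U_1$ the set of defective items that are not sure ones. In the second stage all items of $\mathcal U_0\cup\mathcal U_1$ are tested individually, so that the mean number of tests is $$T_{M,C,p}=M+\sum_{X\in\{0,1\}^N}\mu_p(X)\bigl(|\mathcal U_0|+|\mathcal U_1|\bigr).$$ Let $$\overline T(N,p)=\min_{1\le M\le N}\ \min_{C\in\{0,1\}^{N\times M}}T_{M,C,p}$$ be the optimal mean number of tests over all two-stage algorithms. **Theorem 1.** (i) For every $\beta\in(0,1/2)$,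 with $p=N^{-\beta}$, $$\lim_{N\to\infty}\frac{\overline T(N,p)}{Np|\log p|}=\frac1{(\log 2)^2}.$$ (ii) (The case "$\beta=0$".) For every $p\in(0,1)$ the limit $\lim_{N\to\infty}\frac{\overline T(N,p)}{Np|\log p|}$ exists, and $$\lim_{p\to0^+}\,\lim_{N\to\infty}\frac{\overline T(N,p)}{Np|\log p|}=\frac1{(\log 2)^2}.$$ -/

import Mathlib

open Filter Topology

namespace GroupTesting

section Pools

variable {ι κ : Type} [Fintype ι] [Fintype κ] [DecidableEq ι]

/-- The items are indexed by `ι`, the tests of the first stage by `κ`. The connectivity matrix `C`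
says whether item `i` belongs to pool `a`, the configuration `X` whether item `i` is defective.
Test `a` is positive if its pool contains at least one defective item. -/
abbrev TestPositive (C : ι → κ → Bool) (X : ι → Bool) (a : κ) : Prop :=
  ∃ i, C i a = true ∧ X i = true

/-- Items which belong to at least one pool whose test is negative. -/
def sureZeros (C : ι → κ → Bool) (X : ι → Bool) : Finset ι :=
  Finset.univ.filter fun i => ∃ a, C i a = true ∧ ¬ TestPositive C X a

/-- Items which belong to at least one pool whose test is positive and all of whose other
members are sure zeros. -/
def sureOnes (C : ι → κ → Bool) (X : ι → Bool) : Finset ι :=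
  Finset.univ.filter fun i => ∃ a, C i a = true ∧ TestPositive C X a ∧
    ∀ j, j ≠ i → C j a = true → j ∈ sureZeros C X

/-- Non-defective items which are not sure zeros. -/
def undeterminedZeros (C : ι → κ → Bool) (X : ι → Bool) : Finset ι :=
  (Finset.univ.filter fun i => X i = false) \ sureZeros C X

/-- Defective items which are not sure ones. -/
def undeterminedOnes (C : ι → κ → Bool) (X : ι → Bool) : Finset ι :=
  (Finset.univ.filter fun i => X i = true) \ sureOnes C X

/-- Total number of tests: all tests of the first stage, and one individual test in the second
stage for each item left undetermined by the first stage. -/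
def numTests (C : ι → κ → Bool) (X : ι → Bool) : ℕ :=
  Fintype.card κ + (undeterminedZeros C X).card + (undeterminedOnes C X).card

/-- Bernoulli product weight of a configuration: each item is defective with probability `p`,
independently. -/
noncomputable def bernoulliWeight (p : ℝ) (X : ι → Bool) : ℝ :=
  ∏ i, if X i = true then p else 1 - p

/-- Mean number of tests under the Bernoulli product measure. -/
noncomputable def meanTests (C : ι → κ → Bool) (p : ℝ) : ℝ :=
  ∑ X : ι → Bool, bernoulliWeight p X * (numTests C X : ℝ)

end Pools

/-- The values of the mean number of tests over all two-stage algorithms on `N` items, that is,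
over all numbers `1 ≤ M ≤ N` of first-stage tests and all `N × M` connectivity matrices. -/
def meanTestsValues (N : ℕ) (p : ℝ) : Set ℝ :=
  {t | ∃ M : ℕ, 1 ≤ M ∧ M ≤ N ∧ ∃ C : Fin N → Fin M → Bool, t = meanTests C p}

/-- The optimal mean number of tests over all two-stage algorithms. -/
noncomputable def optimalMeanTests (N : ℕ) (p : ℝ) : ℝ :=
  sInf (meanTestsValues N p)

theorem finite_meanTestsValues (N : ℕ) (p : ℝ) : (meanTestsValues N p).Finite := by
  have h : meanTestsValues N p ⊆
      ⋃ M ∈ Set.Iic N, Set.range fun C : Fin N → Fin M → Bool => meanTests C p := by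
    rintro t ⟨M, -, hM, C, rfl⟩
    exact Set.mem_biUnion (Set.mem_Iic.2 hM) ⟨C, rfl⟩
  exact ((Set.finite_Iic N).biUnion fun M _ => Set.finite_range _).subset h

/-- The infimum is a minimum. -/
theorem isLeast_optimalMeanTests {N : ℕ} (hN : 1 ≤ N) (p : ℝ) :
    IsLeast (meanTestsValues N p) (optimalMeanTests N p) := by
  have hf := finite_meanTestsValues N p
  have hne : (meanTestsValues N p).Nonempty := ⟨_, N, hN, le_rfl, fun _ _ => true, rfl⟩
  exact ⟨hne.csInf_mem hf, fun t ht => csInf_le hf.bddBelow ht⟩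

end GroupTesting

/-! Write `c` for `poolEfficiency p`, which is asymptotic to `(log 2)^2 / p` as `p` tends to `0`.

Lower bound. Given that item `i` is healthy, its tests are increasing events, so by Harris'
inequality it stays undetermined with probability at least the product, over its pools `a`, of `1 -
(1 - p)^(n_a - 1)`, where `n_a` is the pool size. Write this product as `exp y`, with `y` a sum of
logarithms over the pools of `i`, and replace the exponential by a tangent line of slope `1 / c`.
The bound is now linear, and summing over items regroups it by pools. A pool of `n ≥ 2` items loses
at most `n |log (1 - (1 - p)^(n - 1))| / c ≤ 1`, which is exactly the test it costs. Here `log x *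
log (1 - x) ≤ (log 2)^2` enters: the best pools are positive with probability about one half. What
remains is `N * testRate p`, for every `N`, and `testRate p` is asymptotic to `p |log p| / (log
2)^2`.

Upper bound. Partition the items at random into about `N p / log 2` pools, independently about `log₂
(1 / p)` times. Unless there are unusually many defectives, a healthy item is contaminated in every
partition with probability at most `p`. A Chernoff bound controls the exceptional configurations, at
a cost `O(N p)` as soon as `N p^2 ≥ 1`; this is where `β < 1/2` is used. The average over partitions
bounds the optimum.

For fixed `p` the limit in `N` exists by Fekete's lemma: testing two groups separately makes the
optimum subadditive. Both bounds are uniform enough in `N` to pass to that limit. -/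

namespace GroupTesting

/-! ### Product measures, correlation of tests, undetermined zeros -/

section ProductWeight

set_option linter.unusedSectionVars false

variable {ι κ : Type} [Fintype ι] [Fintype κ] [DecidableEq ι]

/-- Product weight of a configuration in which item `i` is defective with probability `r i`,
independently of the others. -/
def productWeight (r : ι → ℝ) (X : ι → Bool) : ℝ :=
  ∏ i, if X i = true then r i else 1 - r i

theorem sum_prod_bool (h : ι → Bool → ℝ) :
    ∑ X : ι → Bool, ∏ i, h i (X i) = ∏ i, (h i true + h i false) := by
  have := Finset.prod_univ_sum (fun _ : ι => (Finset.univ : Finset Bool)) h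
  rw [Fintype.piFinset_univ] at this
  rw [← this]
  simp

theorem sum_productWeight (r : ι → ℝ) : ∑ X, productWeight r X = 1 := by
  unfold productWeight
  rw [sum_prod_bool (fun i b => if b = true then r i else 1 - r i)]
  simp

theorem productWeight_nonneg {r : ι → ℝ} (h0 : ∀ i, 0 ≤ r i) (h1 : ∀ i, r i ≤ 1)
    (X : ι → Bool) : 0 ≤ productWeight r X := by
  refine Finset.prod_nonneg fun i _ => ?_
  split_ifs
  · exact h0 i
  · linarith [h1 i]

/-- In each coordinate the meet and join only permute the two values. This is the lattice condition
of `fkg`, here with equality. -/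
theorem productWeight_inf_mul_sup (r : ι → ℝ) (X Y : ι → Bool) :
    productWeight r X * productWeight r Y = productWeight r (X ⊓ Y) * productWeight r (X ⊔ Y) := by
  unfold productWeight
  rw [← Finset.prod_mul_distrib, ← Finset.prod_mul_distrib]
  refine Finset.prod_congr rfl fun i _ => ?_
  cases hX : X i <;> cases hY : Y i <;> simp [hX, hY, mul_comm]

theorem monotone_testPositive (C : ι → κ → Bool) (a : κ) :
    Monotone fun X : ι → Bool => TestPositive C X a := by
  rintro X Y h ⟨i, hi, hX⟩
  exact ⟨i, hi, h i hX⟩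

/-- The indicator of a positive test. -/
noncomputable def positiveIndicator (C : ι → κ → Bool) (a : κ) (X : ι → Bool) : ℝ :=
  if TestPositive C X a then 1 else 0

theorem positiveIndicator_nonneg (C : ι → κ → Bool) (a : κ) (X : ι → Bool) :
    0 ≤ positiveIndicator C a X := by
  unfold positiveIndicator; split_ifs <;> norm_num

theorem monotone_positiveIndicator (C : ι → κ → Bool) (a : κ) :
    Monotone (positiveIndicator C a) := by
  intro X Y h
  unfold positiveIndicator
  by_cases hX : TestPositive C X a
  · rw [if_pos hX, if_pos (monotone_testPositive C a h hX)]
  · rw [if_neg hX]; split_ifs <;> norm_num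

/-- Harris' inequality: positive tests are positively correlated. -/
theorem prod_sum_positiveIndicator_le {r : ι → ℝ} (h0 : ∀ i, 0 ≤ r i) (h1 : ∀ i, r i ≤ 1)
    (C : ι → κ → Bool) (s : Finset κ) :
    ∏ a ∈ s, ∑ X, productWeight r X * positiveIndicator C a X ≤
      ∑ X, productWeight r X * ∏ a ∈ s, positiveIndicator C a X := by
  classical
  induction s using Finset.induction_on with
  | empty => simp [sum_productWeight]
  | insert a s ha ih =>
    simp only [Finset.prod_insert ha]
    calc _ ≤ (∑ X, productWeight r X * positiveIndicator C a X) *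
          ∑ X, productWeight r X * ∏ a ∈ s, positiveIndicator C a X :=
          mul_le_mul_of_nonneg_left ih (Finset.sum_nonneg fun X _ =>
            mul_nonneg (productWeight_nonneg h0 h1 X) (positiveIndicator_nonneg C a X))
      _ ≤ (∑ X, productWeight r X) *
          ∑ X, productWeight r X * (positiveIndicator C a X * ∏ a ∈ s, positiveIndicator C a X) :=
          fkg (μ := productWeight r) (f := positiveIndicator C a) (g := fun X => ∏ a ∈ s, positiveIndicator C a X)
            (fun X => productWeight_nonneg h0 h1 X) (fun X => positiveIndicator_nonneg C a X)
            (fun X => Finset.prod_nonneg fun b _ => positiveIndicator_nonneg C b X)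
            (monotone_positiveIndicator C a)
            (fun X Y h => Finset.prod_le_prod (fun b _ => positiveIndicator_nonneg C b X)
              fun b _ => monotone_positiveIndicator C b h)
            (fun X Y => (productWeight_inf_mul_sup r X Y).le)
      _ = _ := by rw [sum_productWeight, one_mul]

theorem sum_productWeight_positiveIndicator (r : ι → ℝ) (C : ι → κ → Bool) (a : κ) :
    ∑ X, productWeight r X * positiveIndicator C a X =
      1 - ∏ i, if C i a = true then 1 - r i else 1 := by
  have h : ∀ X, productWeight r X * positiveIndicator C a X = productWeight r X -
      ∏ i, if X i = true then (if C i a = true then 0 else r i) else 1 - r i := by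
    intro X
    unfold positiveIndicator
    split_ifs with hX
    · obtain ⟨i, hi, hXi⟩ := hX
      rw [mul_one, Finset.prod_eq_zero (Finset.mem_univ i) (by simp [hi, hXi]), sub_zero]
    · rw [mul_zero, eq_comm, sub_eq_zero]
      refine Finset.prod_congr rfl fun i _ => ?_
      by_cases hXi : X i = true
      · have : ¬ C i a = true := fun hC => hX ⟨i, hC, hXi⟩
        simp [hXi, this]
      · simp [hXi]
  simp only [h, Finset.sum_sub_distrib, sum_productWeight]
  rw [sum_prod_bool (fun i b => if b = true then (if C i a = true then 0 else r i) else 1 - r i)]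
  congr 1
  refine Finset.prod_congr rfl fun i _ => ?_
  by_cases hC : C i a = true <;> simp [hC]

/-- The number of items in a pool. -/
def poolSize (C : ι → κ → Bool) (a : κ) : ℕ :=
  (Finset.univ.filter fun i => C i a = true).card

theorem prod_pool_update {p : ℝ} {C : ι → κ → Bool} {a : κ} {i : ι} (hi : C i a = true) :
    (∏ j, if C j a = true then 1 - Function.update (fun _ => p) i 0 j else 1) =
      (1 - p) ^ (poolSize C a - 1) := by
  rw [← Finset.prod_filter, ← Finset.mul_prod_erase _ _ (show i ∈ _ by simpa using hi)]
  simp only [Function.update_self, sub_zero, one_mul]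
  rw [Finset.prod_congr rfl (g := fun _ => 1 - p), Finset.prod_const, Finset.card_erase_of_mem
    (by simpa using hi), poolSize]
  intro j hj
  rw [Function.update_of_ne (Finset.ne_of_mem_erase hj)]

theorem productWeight_update_of_false (p : ℝ) {X : ι → Bool} {i : ι} (hX : X i = false) :
    (1 - p) * productWeight (Function.update (fun _ => p) i 0) X = bernoulliWeight p X := by
  unfold productWeight bernoulliWeight
  rw [← Finset.mul_prod_erase _ _ (Finset.mem_univ i),
    ← Finset.mul_prod_erase Finset.univ (fun i => if X i = true then p else 1 - p)
      (Finset.mem_univ i)]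
  simp only [hX, Function.update_self]
  simp only [Bool.false_eq_true, if_false, sub_zero, one_mul]
  congr 1
  refine Finset.prod_congr rfl fun j hj => ?_
  rw [Function.update_of_ne (Finset.ne_of_mem_erase hj)]

theorem productWeight_update_of_true (p : ℝ) {X : ι → Bool} {i : ι} (hX : X i = true) :
    productWeight (Function.update (fun _ => p) i 0) X = 0 :=
  Finset.prod_eq_zero (Finset.mem_univ i) (by simp [hX])

theorem mem_undeterminedZeros {C : ι → κ → Bool} {X : ι → Bool} {i : ι} :
    i ∈ undeterminedZeros C X ↔ X i = false ∧ ∀ a, C i a = true → TestPositive C X a := by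
  simp only [undeterminedZeros, sureZeros, Finset.mem_sdiff, Finset.mem_filter, Finset.mem_univ,
    true_and, not_exists, not_and]
  refine and_congr_right fun _ => forall_congr' fun a => imp_congr_right fun _ => ?_
  simp [TestPositive]

/-- Lower bound on the probability that an item is an undetermined zero. -/
theorem mul_prod_le_sum_undeterminedZeros {p : ℝ} (hp0 : 0 ≤ p) (hp1 : p ≤ 1)
    (C : ι → κ → Bool) (i : ι) :
    (1 - p) * ∏ a with C i a = true, (1 - (1 - p) ^ (poolSize C a - 1)) ≤
      ∑ X, bernoulliWeight p X * if i ∈ undeterminedZeros C X then 1 else 0 := by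
  -- Defect probability `0` at `i` amounts to conditioning on `i` being healthy; the factor `1 - p`
  -- restores the original weight. Hence the exponent `poolSize C a - 1`.
  set r : ι → ℝ := Function.update (fun _ => p) i 0 with hr
  have h0 : ∀ j, 0 ≤ r j := by
    intro j; by_cases hj : j = i
    · subst hj; simp [hr]
    · simp [hr, Function.update_of_ne hj, hp0]
  have h1 : ∀ j, r j ≤ 1 := by
    intro j; by_cases hj : j = i
    · subst hj; simp [hr]
    · simp [hr, Function.update_of_ne hj, hp1]
  calc _ = (1 - p) * ∏ a with C i a = true, ∑ X, productWeight r X * positiveIndicator C a X := by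
        congr 1
        refine Finset.prod_congr rfl fun a ha => ?_
        rw [sum_productWeight_positiveIndicator, prod_pool_update (Finset.mem_filter.1 ha).2]
    _ ≤ (1 - p) * ∑ X, productWeight r X * ∏ a with C i a = true, positiveIndicator C a X :=
        mul_le_mul_of_nonneg_left (prod_sum_positiveIndicator_le h0 h1 C _) (by linarith)
    _ = _ := by
        rw [Finset.mul_sum]
        refine Finset.sum_congr rfl fun X _ => ?_
        rw [← mul_assoc]
        cases hX : X i
        · rw [productWeight_update_of_false p hX]
          congr 1
          split_ifs with h
          · rw [mem_undeterminedZeros] at h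
            refine Finset.prod_eq_one fun a ha => ?_
            exact if_pos (h.2 a (Finset.mem_filter.1 ha).2)
          · rw [mem_undeterminedZeros] at h
            simp only [hX, true_and, not_forall] at h
            obtain ⟨a, ha, h⟩ := h
            exact Finset.prod_eq_zero (Finset.mem_filter.2 ⟨Finset.mem_univ a, ha⟩) (if_neg h)
        · rw [productWeight_update_of_true p hX, if_neg]
          · simp
          · rw [mem_undeterminedZeros]; simp [hX]

theorem bernoulliWeight_nonneg {p : ℝ} (hp0 : 0 ≤ p) (hp1 : p ≤ 1) (X : ι → Bool) :
    0 ≤ bernoulliWeight p X :=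
  productWeight_nonneg (fun _ => hp0) (fun _ => hp1) X

theorem sum_bernoulliWeight (p : ℝ) : ∑ X : ι → Bool, bernoulliWeight p X = 1 :=
  sum_productWeight _

theorem meanTests_eq (C : ι → κ → Bool) (p : ℝ) :
    meanTests C p = Fintype.card κ +
      ∑ X, bernoulliWeight p X * ((undeterminedZeros C X).card : ℝ) +
      ∑ X, bernoulliWeight p X * ((undeterminedOnes C X).card : ℝ) := by
  simp only [meanTests, numTests, Nat.cast_add, mul_add, Finset.sum_add_distrib]
  rw [← Finset.sum_mul, sum_bernoulliWeight, one_mul]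

theorem sum_bernoulliWeight_mul_card (p : ℝ) (s : (ι → Bool) → Finset ι) :
    ∑ X, bernoulliWeight p X * ((s X).card : ℝ) =
      ∑ i, ∑ X, bernoulliWeight p X * if i ∈ s X then 1 else 0 := by
  rw [Finset.sum_comm]
  refine Finset.sum_congr rfl fun X _ => ?_
  rw [← Finset.mul_sum]
  simp

theorem meanTests_nonneg {p : ℝ} (hp0 : 0 ≤ p) (hp1 : p ≤ 1) (C : ι → κ → Bool) :
    0 ≤ meanTests C p :=
  Finset.sum_nonneg fun X _ => mul_nonneg (bernoulliWeight_nonneg hp0 hp1 X) (Nat.cast_nonneg _)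

end ProductWeight

/-! ### Efficiency of one pool and the tangent-line bound -/

/-- By concavity the secant slopes of `log` from the point `1` decrease; compare them at `x` and `1
- x`. This gives the sign of the derivative of `log x * log (1 - x)`. -/
theorem log_one_sub_mul_le {x : ℝ} (h0 : 0 < x) (h1 : x < 1 / 2) :
    x * Real.log x ≤ (1 - x) * Real.log (1 - x) := by
  have h := strictConcaveOn_log_Ioi.concaveOn.neg.secant_mono (a := 1) (x := x) (y := 1 - x)
    (by simp) (by simpa using h0) (by simp; linarith) (by linarith) (by linarith) (by linarith)
  simp only [Pi.neg_apply] at h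
  rw [Real.log_one, neg_zero, sub_zero, sub_zero, show 1 - x - 1 = -x by ring,
    show x - 1 = -(1 - x) by ring, neg_div_neg_eq, neg_div_neg_eq,
    div_le_div_iff₀ (by linarith) h0] at h
  linarith

theorem log_mul_log_one_sub_le_of_le_half {x : ℝ} (h0 : 0 < x) (h1 : x ≤ 1 / 2) :
    Real.log x * Real.log (1 - x) ≤ Real.log 2 ^ 2 := by
  have hd : ∀ y ∈ Set.Icc x (1 / 2), HasDerivAt (fun y => Real.log y * Real.log (1 - y))
      (y⁻¹ * Real.log (1 - y) + Real.log y * (-1 / (1 - y))) y := by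
    intro y hy
    have hy0 : y ≠ 0 := by linarith [hy.1]
    have hy1 : 1 - y ≠ 0 := by linarith [hy.2]
    exact (Real.hasDerivAt_log hy0).mul (((hasDerivAt_id y).const_sub 1).log hy1)
  have hm : MonotoneOn (fun y => Real.log y * Real.log (1 - y)) (Set.Icc x (1 / 2)) := by
    refine monotoneOn_of_deriv_nonneg (convex_Icc _ _)
      (fun y hy => (hd y hy).continuousAt.continuousWithinAt)
      (fun y hy => (hd y (interior_subset hy)).differentiableAt.differentiableWithinAt)
      fun y hy => ?_
    rw [(hd y (interior_subset hy)).deriv]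
    rw [interior_Icc] at hy
    have hy0 : 0 < y := h0.trans hy.1
    have hy1 : 0 < 1 - y := by linarith [hy.2]
    have := log_one_sub_mul_le hy0 hy.2
    have e : y⁻¹ * Real.log (1 - y) + Real.log y * (-1 / (1 - y)) =
        ((1 - y) * Real.log (1 - y) - y * Real.log y) / (y * (1 - y)) := by
      field_simp; ring
    rw [e]
    exact div_nonneg (by linarith) (by positivity)
  have h := hm (Set.left_mem_Icc.2 h1) (Set.right_mem_Icc.2 h1) h1
  refine h.trans (le_of_eq ?_)
  change Real.log (1 / 2) * Real.log (1 - 1 / 2) = _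
  rw [show (1 : ℝ) - 1 / 2 = 2⁻¹ by norm_num, one_div, Real.log_inv]
  ring

theorem log_mul_log_one_sub_le {x : ℝ} (h0 : 0 < x) (h1 : x < 1) :
    Real.log x * Real.log (1 - x) ≤ Real.log 2 ^ 2 := by
  rcases le_total x (1 / 2) with h | h
  · exact log_mul_log_one_sub_le_of_le_half h0 h
  · have := log_mul_log_one_sub_le_of_le_half (x := 1 - x) (by linarith) (by linarith)
    rwa [sub_sub_cancel, mul_comm] at this

/-- Upper bound on the efficiency `n * |log (1 - (1 - p) ^ (n - 1))|` of a pool of `n` items. -/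
noncomputable def poolEfficiency (p : ℝ) : ℝ := Real.log 2 ^ 2 / p - Real.log p

theorem poolEfficiency_pos {p : ℝ} (h0 : 0 < p) (h1 : p < 1) : 0 < poolEfficiency p := by
  have := Real.log_neg h0 h1
  have h2 : 0 < Real.log 2 ^ 2 / p := by have := Real.log_pos one_lt_two; positivity
  unfold poolEfficiency; linarith

theorem one_sub_pow_mem {p : ℝ} (h0 : 0 < p) (h1 : p < 1) {n : ℕ} (hn : 1 ≤ n) :
    0 < (1 - p) ^ n ∧ (1 - p) ^ n ≤ 1 - p := by
  refine ⟨pow_pos (by linarith) _, ?_⟩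
  exact pow_le_of_le_one (by linarith) (by linarith) (by omega)

/-- Put `x = (1 - p)^(n - 1)`. Since `(n - 1) p ≤ -log x`, the product bound on logarithms handles
`n - 1` of the `n` terms; the last is at least `log p` because `1 - x ≥ p`. -/
theorem neg_poolEfficiency_le {p : ℝ} (h0 : 0 < p) (h1 : p < 1) {n : ℕ} (hn : 2 ≤ n) :
    -poolEfficiency p ≤ n * Real.log (1 - (1 - p) ^ (n - 1)) := by
  obtain ⟨k, rfl⟩ : ∃ k, n = k + 1 := ⟨n - 1, by omega⟩
  obtain ⟨hx0, hx1⟩ := one_sub_pow_mem h0 h1 (n := k) (by omega)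
  rw [Nat.add_sub_cancel]
  set x := (1 - p) ^ k with hx
  have hlog : Real.log x ≤ -(k * p) := by
    rw [hx, Real.log_pow]
    have : Real.log (1 - p) ≤ -p := by
      have := Real.log_le_sub_one_of_pos (show 0 < 1 - p by linarith); linarith
    nlinarith [(Nat.cast_nonneg k : (0 : ℝ) ≤ k)]
  have hneg : Real.log (1 - x) < 0 := Real.log_neg (by linarith) (by linarith)
  have hone : Real.log p ≤ Real.log (1 - x) := Real.log_le_log h0 (by linarith)
  have hprod := log_mul_log_one_sub_le hx0 (by linarith)
  have hk : -(Real.log 2 ^ 2 / p) ≤ k * Real.log (1 - x) := by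
    rw [neg_le, le_div_iff₀ h0]
    nlinarith
  unfold poolEfficiency
  push_cast
  linarith

/-- Lower bound on the optimal number of tests per item. -/
noncomputable def testRate (p : ℝ) : ℝ :=
  (1 + Real.log (poolEfficiency p * (1 - p))) / poolEfficiency p

/-- Ensures that a pool with a single member pays for that member. -/
theorem testRate_le_one {p : ℝ} (h0 : 0 < p) (h1 : p < 1) : testRate p ≤ 1 := by
  have hc := poolEfficiency_pos h0 h1
  unfold testRate
  rw [div_le_one hc]
  have := Real.log_le_sub_one_of_pos (mul_pos hc (show 0 < 1 - p by linarith))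
  nlinarith

/-- The left side is the tangent to `y ↦ (1 - p) * exp y` of slope `1 / poolEfficiency p`, the slope
at which the loss caused by a pool is at most one test. -/
theorem testRate_add_le {p y : ℝ} (h0 : 0 < p) (h1 : p < 1) :
    testRate p + y / poolEfficiency p ≤ (1 - p) * Real.exp y := by
  have hc := poolEfficiency_pos h0 h1
  have hp : 0 < 1 - p := by linarith
  unfold testRate
  rw [← add_div, div_le_iff₀ hc]
  have := Real.add_one_le_exp (Real.log (poolEfficiency p * (1 - p)) + y)
  rw [Real.exp_add, Real.exp_log (by positivity)] at this
  linarith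

/-! ### Lower bound valid for every connectivity matrix -/

section LowerBound

set_option linter.unusedSectionVars false

variable {ι κ : Type} [Fintype ι] [Fintype κ] [DecidableEq ι]

/-- Items which are not alone in any of their pools. -/
def sharedItems (C : ι → κ → Bool) : Finset ι :=
  Finset.univ.filter fun i => ∀ a, C i a = true → 2 ≤ poolSize C a

/-- Singleton pools are treated apart, since their logarithm would be that of `0`. Choosing for each
remaining item a pool containing only it is injective. -/
theorem card_compl_sharedItems_le (C : ι → κ → Bool) :
    (sharedItems C)ᶜ.card ≤ (Finset.univ.filter fun a => poolSize C a < 2).card := by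
  classical
  have h : ∀ i ∈ (sharedItems C)ᶜ, ∃ a, C i a = true ∧ poolSize C a < 2 := by
    intro i hi
    simpa [sharedItems] using hi
  rcases (sharedItems C)ᶜ.eq_empty_or_nonempty with h0 | ⟨i, hi⟩
  · simp [h0]
  have : Nonempty κ := ⟨(h i hi).choose⟩
  choose! f hf using h
  refine Finset.card_le_card_of_injOn f (fun i hi => ?_) fun i hi j hj hij => ?_
  · simpa using (hf i hi).2
  · have hc : poolSize C (f i) ≤ 1 := by have := (hf i hi).2; omega
    refine Finset.card_le_one.1 hc i ?_ j ?_
    · simpa using (hf i hi).1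
    · simpa [hij] using (hf j hj).1

theorem testRate_add_sum_log_le {p : ℝ} (h0 : 0 < p) (h1 : p < 1) (C : ι → κ → Bool) {i : ι}
    (hi : i ∈ sharedItems C) :
    testRate p + (∑ a with C i a = true, Real.log (1 - (1 - p) ^ (poolSize C a - 1))) /
        poolEfficiency p ≤
      ∑ X, bernoulliWeight p X * if i ∈ undeterminedZeros C X then 1 else 0 := by
  refine ((testRate_add_le h0 h1).trans_eq ?_).trans
    (mul_prod_le_sum_undeterminedZeros h0.le h1.le C i)
  rw [Real.exp_sum]
  congr 1
  refine Finset.prod_congr rfl fun a ha => Real.exp_log ?_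
  have := (Finset.mem_filter.1 hi).2 a (Finset.mem_filter.1 ha).2
  have := one_sub_pow_mem h0 h1 (n := poolSize C a - 1) (by omega)
  linarith

/-- After exchanging the sums, a pool's nonpositive logarithm occurs at most `poolSize C a` times,
so `neg_poolEfficiency_le` applies pool by pool. -/
theorem neg_mul_le_sum_sum_log {p : ℝ} (h0 : 0 < p) (h1 : p < 1) (C : ι → κ → Bool) :
    -(((Finset.univ.filter fun a => ¬ poolSize C a < 2).card : ℝ) * poolEfficiency p) ≤
      ∑ i ∈ sharedItems C, ∑ a with C i a = true,
        Real.log (1 - (1 - p) ^ (poolSize C a - 1)) := by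
  simp only [Finset.sum_filter (fun a => C _ a = true)]
  rw [Finset.sum_comm, ← mul_neg, ← nsmul_eq_mul, ← Finset.sum_const, Finset.sum_filter]
  refine Finset.sum_le_sum fun a _ => ?_
  by_cases ha : ¬ poolSize C a < 2
  · rw [if_pos ha, ← Finset.sum_filter, Finset.sum_const, nsmul_eq_mul]
    have hn : 2 ≤ poolSize C a := by omega
    refine (neg_poolEfficiency_le h0 h1 hn).trans ?_
    obtain ⟨hx0, hx1⟩ := one_sub_pow_mem h0 h1 (n := poolSize C a - 1) (by omega)
    have hneg : Real.log (1 - (1 - p) ^ (poolSize C a - 1)) ≤ 0 :=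
      Real.log_nonpos (by linarith) (by linarith)
    refine mul_le_mul_of_nonpos_right ?_ hneg
    exact_mod_cast Finset.card_le_card
      (Finset.filter_subset_filter _ (Finset.subset_univ (sharedItems C)))
  · rw [if_neg ha]
    refine Finset.sum_nonneg fun i hi => ?_
    split_ifs with hC
    · exact absurd ((Finset.mem_filter.1 hi).2 a hC) (by omega)
    · exact le_rfl

theorem card_mul_testRate_le_meanTests {p : ℝ} (h0 : 0 < p) (h1 : p < 1) (C : ι → κ → Bool) :
    (Fintype.card ι : ℝ) * testRate p ≤ meanTests C p := by
  have hc := poolEfficiency_pos h0 h1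
  have hU1 : 0 ≤ ∑ X, bernoulliWeight p X * ((undeterminedOnes C X).card : ℝ) :=
    Finset.sum_nonneg fun X _ =>
      mul_nonneg (bernoulliWeight_nonneg h0.le h1.le X) (Nat.cast_nonneg _)
  have hU0 : (sharedItems C).card * testRate p -
      ((Finset.univ.filter fun a => ¬ poolSize C a < 2).card : ℝ) ≤
      ∑ X, bernoulliWeight p X * ((undeterminedZeros C X).card : ℝ) := by
    rw [sum_bernoulliWeight_mul_card]
    calc _ ≤ ∑ i ∈ sharedItems C, (testRate p + (∑ a with C i a = true,
          Real.log (1 - (1 - p) ^ (poolSize C a - 1))) / poolEfficiency p) := by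
          rw [Finset.sum_add_distrib, Finset.sum_const, nsmul_eq_mul, ← Finset.sum_div,
            sub_eq_add_neg]
          refine add_le_add_right ?_ _
          rw [le_div_iff₀ hc, neg_mul]
          exact neg_mul_le_sum_sum_log h0 h1 C
      _ ≤ ∑ i ∈ sharedItems C,
          ∑ X, bernoulliWeight p X * if i ∈ undeterminedZeros C X then 1 else 0 :=
          Finset.sum_le_sum fun i hi => testRate_add_sum_log_le h0 h1 C hi
      _ ≤ _ := Finset.sum_le_sum_of_subset_of_nonneg (Finset.subset_univ _) fun i _ _ =>
          Finset.sum_nonneg fun X _ => mul_nonneg (bernoulliWeight_nonneg h0.le h1.le X)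
            (by split_ifs <;> norm_num)
  have hM : (Fintype.card κ : ℝ) = (Finset.univ.filter fun a => poolSize C a < 2).card +
      (Finset.univ.filter fun a => ¬ poolSize C a < 2).card := by
    exact_mod_cast (Finset.card_filter_add_card_filter_not (s := Finset.univ)
      (fun a => poolSize C a < 2)).symm
  have hS : ((sharedItems C)ᶜ.card : ℝ) ≤ (Finset.univ.filter fun a => poolSize C a < 2).card := by
    exact_mod_cast card_compl_sharedItems_le C
  have hN : (Fintype.card ι : ℝ) = (sharedItems C).card + (sharedItems C)ᶜ.card := by
    exact_mod_cast (Finset.card_add_card_compl (sharedItems C)).symm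
  have ht : ((sharedItems C)ᶜ.card : ℝ) * testRate p ≤ (sharedItems C)ᶜ.card :=
    mul_le_of_le_one_right (Nat.cast_nonneg _) (testRate_le_one h0 h1)
  rw [meanTests_eq, hN, add_mul]
  linarith

end LowerBound

theorem mul_testRate_le_optimalMeanTests {p : ℝ} (h0 : 0 < p) (h1 : p < 1) {N : ℕ} (hN : 1 ≤ N) :
    N * testRate p ≤ optimalMeanTests N p := by
  obtain ⟨M, -, -, C, h⟩ := (isLeast_optimalMeanTests hN p).1
  rw [h]
  simpa using card_mul_testRate_le_meanTests h0 h1 C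

/-! ### Asymptotics of the lower bound as `p` tends to zero -/

theorem tendsto_poolEfficiency_mul :
    Tendsto (fun p => poolEfficiency p * p) (𝓝[>] 0) (𝓝 (Real.log 2 ^ 2)) := by
  have h : Tendsto (fun p : ℝ => Real.log 2 ^ 2 - Real.log p * p) (𝓝[>] 0)
      (𝓝 (Real.log 2 ^ 2 - 0)) := by
    refine tendsto_const_nhds.sub ?_
    simpa using tendsto_log_mul_rpow_nhdsGT_zero one_pos
  rw [sub_zero] at h
  refine h.congr' ?_
  filter_upwards [self_mem_nhdsWithin] with p hp
  have : p ≠ 0 := ne_of_gt hp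
  unfold poolEfficiency
  field_simp

theorem tendsto_testRate_div :
    Tendsto (fun p => testRate p / (p * |Real.log p|)) (𝓝[>] 0) (𝓝 (1 / Real.log 2 ^ 2)) := by
  have hl2 : (0 : ℝ) < Real.log 2 ^ 2 := by have := Real.log_pos one_lt_two; positivity
  have hid : Tendsto (fun p : ℝ => 1 - p) (𝓝[>] 0) (𝓝 1) := by
    have : Tendsto (fun p : ℝ => 1 - p) (𝓝 0) (𝓝 (1 - 0)) := by
      exact tendsto_const_nhds.sub tendsto_id
    rw [sub_zero] at this
    exact this.mono_left nhdsWithin_le_nhds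
  have hnum : Tendsto (fun p => 1 + Real.log (poolEfficiency p * p * (1 - p))) (𝓝[>] 0)
      (𝓝 (1 + Real.log (Real.log 2 ^ 2 * 1))) :=
    tendsto_const_nhds.add ((tendsto_poolEfficiency_mul.mul hid).log (by positivity))
  have habs : Tendsto (fun p => -Real.log p) (𝓝[>] 0) atTop :=
    tendsto_neg_atBot_atTop.comp Real.tendsto_log_nhdsGT_zero
  have hfrac := (hnum.div_atTop habs).add_const 1
  have hfin := hfrac.div tendsto_poolEfficiency_mul hl2.ne'
  rw [zero_add] at hfin
  refine hfin.congr' ?_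
  filter_upwards [Ioo_mem_nhdsGT (zero_lt_one' ℝ)] with p hp
  have hc := poolEfficiency_pos hp.1 hp.2
  have hlog := Real.log_neg hp.1 hp.2
  have hp0 := hp.1
  have hp1 : 0 < 1 - p := by linarith [hp.2]
  simp only [Pi.div_apply]
  rw [abs_of_neg hlog, show poolEfficiency p * p * (1 - p) = poolEfficiency p * (1 - p) * p by ring,
    Real.log_mul (by positivity) hp0.ne', testRate]
  have hne : Real.log p ≠ 0 := hlog.ne
  field_simp
  ring

/-! ### Relabelling items and tests; trivial bounds -/

section Reindex

set_option linter.unusedSectionVars false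

variable {ι κ ι' κ' : Type} [Fintype ι] [Fintype κ] [DecidableEq ι] [Fintype ι'] [Fintype κ']
  [DecidableEq ι']

theorem mem_sureZeros {C : ι → κ → Bool} {X : ι → Bool} {i : ι} :
    i ∈ sureZeros C X ↔ ∃ a, C i a = true ∧ ¬ TestPositive C X a := by
  simp only [sureZeros, Finset.mem_filter, Finset.mem_univ, true_and]

theorem mem_undeterminedOnes {C : ι → κ → Bool} {X : ι → Bool} {i : ι} :
    i ∈ undeterminedOnes C X ↔ X i = true ∧ ¬ ∃ a, C i a = true ∧ TestPositive C X a ∧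
      ∀ j, j ≠ i → C j a = true → j ∈ sureZeros C X := by
  simp only [undeterminedOnes, sureOnes, Finset.mem_sdiff, Finset.mem_filter, Finset.mem_univ,
    true_and]

theorem testPositive_reindex (e : ι' ≃ ι) (e' : κ' ≃ κ) (C : ι → κ → Bool) (X : ι → Bool)
    (a : κ') :
    TestPositive (fun i a => C (e i) (e' a)) (X ∘ e) a ↔ TestPositive C X (e' a) :=
  e.exists_congr_right (q := fun i => C i (e' a) = true ∧ X i = true)

theorem mem_sureZeros_reindex (e : ι' ≃ ι) (e' : κ' ≃ κ) (C : ι → κ → Bool) (X : ι → Bool)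
    (i : ι') :
    i ∈ sureZeros (fun i a => C (e i) (e' a)) (X ∘ e) ↔ e i ∈ sureZeros C X := by
  simp only [mem_sureZeros, testPositive_reindex]
  exact e'.exists_congr_right (q := fun a => C (e i) a = true ∧ ¬ TestPositive C X a)

theorem numTests_reindex (e : ι' ≃ ι) (e' : κ' ≃ κ) (C : ι → κ → Bool) (X : ι → Bool) :
    numTests (fun i a => C (e i) (e' a)) (X ∘ e) = numTests C X := by
  unfold numTests
  congr 1
  · congr 1
    · exact Fintype.card_congr e'
    · refine Finset.card_equiv e fun i => ?_
      simp only [mem_undeterminedZeros, testPositive_reindex]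
      exact and_congr_right fun _ =>
        e'.forall_congr_right (q := fun a => C (e i) a = true → TestPositive C X a)
  · refine Finset.card_equiv e fun i => ?_
    simp only [mem_undeterminedOnes, testPositive_reindex, mem_sureZeros_reindex]
    refine and_congr_right fun _ => not_congr ?_
    rw [← e'.exists_congr_right]
    refine exists_congr fun a => and_congr_right fun _ => and_congr_right fun _ => ?_
    rw [← e.forall_congr_right]
    simp only [ne_eq, e.injective.eq_iff]

theorem meanTests_reindex (e : ι' ≃ ι) (e' : κ' ≃ κ) (C : ι → κ → Bool) (p : ℝ) :
    meanTests (fun i a => C (e i) (e' a)) p = meanTests C p := by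
  unfold meanTests
  refine (Equiv.sum_comp (e.symm.arrowCongr (Equiv.refl Bool)) _).symm.trans
    (Finset.sum_congr rfl fun X _ => ?_)
  have : (e.symm.arrowCongr (Equiv.refl Bool)) X = X ∘ e := by
    ext i; simp
  rw [this, numTests_reindex]
  congr 1
  exact Equiv.prod_comp e fun i => if X i = true then p else 1 - p

end Reindex

/-- Allows algorithms indexed by sums and products of types in place of `Fin N`. -/
theorem optimalMeanTests_le {p : ℝ} {ι κ : Type} [Fintype ι] [Fintype κ] [DecidableEq ι]
    (C : ι → κ → Bool) (h1 : 1 ≤ Fintype.card κ) (h2 : Fintype.card κ ≤ Fintype.card ι) :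
    optimalMeanTests (Fintype.card ι) p ≤ meanTests C p := by
  refine (isLeast_optimalMeanTests (h1.trans h2) p).2 ⟨Fintype.card κ, h1, h2,
    fun i a => C ((Fintype.equivFin ι).symm i) ((Fintype.equivFin κ).symm a), ?_⟩
  exact (meanTests_reindex (Fintype.equivFin ι).symm (Fintype.equivFin κ).symm C p).symm

/-- Testing all items individually in the first stage leaves no undetermined item. -/
theorem meanTests_individual (ι : Type) [Fintype ι] [DecidableEq ι] (p : ℝ) :
    meanTests (fun i j : ι => decide (i = j)) p = Fintype.card ι := by
  have h : ∀ X : ι → Bool, numTests (fun i j : ι => decide (i = j)) X = Fintype.card ι := by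
    intro X
    have h0 : undeterminedZeros (fun i j : ι => decide (i = j)) X = ∅ := by
      ext i
      simp [mem_undeterminedZeros, TestPositive]
    have h1 : undeterminedOnes (fun i j : ι => decide (i = j)) X = ∅ := by
      ext i
      simp only [mem_undeterminedOnes, TestPositive]
      simp +contextual
    simp [numTests, h0, h1]
  unfold meanTests
  simp only [h]
  rw [← Finset.sum_mul, sum_bernoulliWeight, one_mul]

/-- No `M` is admissible, so this is the default infimum of the empty set; it suits subadditivity.
-/
theorem optimalMeanTests_zero (p : ℝ) : optimalMeanTests 0 p = 0 := by
  have : meanTestsValues 0 p = ∅ := by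
    ext t
    simp only [meanTestsValues, Set.mem_ofPred_eq, Set.mem_empty_iff_false, iff_false]
    rintro ⟨M, h1, h2, -⟩
    omega
  rw [optimalMeanTests, this, Real.sInf_empty]

theorem optimalMeanTests_le_self (N : ℕ) (p : ℝ) : optimalMeanTests N p ≤ N := by
  rcases Nat.eq_zero_or_pos N with rfl | hN
  · simp [optimalMeanTests_zero]
  · have := optimalMeanTests_le (p := p) (fun i j : Fin N => decide (i = j))
      (by rw [Fintype.card_fin]; exact hN) le_rfl
    rw [meanTests_individual] at this
    simpa using this

theorem optimalMeanTests_nonneg {p : ℝ} (h0 : 0 ≤ p) (h1 : p ≤ 1) (N : ℕ) :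
    0 ≤ optimalMeanTests N p := by
  refine Real.sInf_nonneg ?_
  rintro t ⟨M, -, -, C, rfl⟩
  exact meanTests_nonneg h0 h1 C

/-! ### Subadditivity by testing two groups separately -/

section DisjointUnion

variable {ι κ ι' κ' : Type} [Fintype ι] [Fintype κ] [DecidableEq ι] [Fintype ι'] [Fintype κ']
  [DecidableEq ι']

/-- Block-diagonal connectivity matrix: the two sets of items are tested separately. -/
def blockMatrix (C : ι → κ → Bool) (C' : ι' → κ' → Bool) : ι ⊕ ι' → κ ⊕ κ' → Bool
  | .inl i, .inl a => C i a
  | .inr i, .inr a => C' i a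
  | _, _ => false

theorem numTests_blockMatrix (C : ι → κ → Bool) (C' : ι' → κ' → Bool) (X : ι ⊕ ι' → Bool) :
    numTests (blockMatrix C C') X =
      numTests C (X ∘ Sum.inl) + numTests C' (X ∘ Sum.inr) := by
  have hp : ∀ a, TestPositive (blockMatrix C C') X (.inl a) ↔ TestPositive C (X ∘ Sum.inl) a := by
    intro a; simp [TestPositive, blockMatrix]
  have hp' : ∀ a, TestPositive (blockMatrix C C') X (.inr a) ↔
      TestPositive C' (X ∘ Sum.inr) a := by
    intro a; simp [TestPositive, blockMatrix]
  have hz : ∀ i, .inl i ∈ sureZeros (blockMatrix C C') X ↔ i ∈ sureZeros C (X ∘ Sum.inl) := by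
    intro i; simp only [mem_sureZeros, Sum.exists]; simp [blockMatrix]
  have hz' : ∀ i, .inr i ∈ sureZeros (blockMatrix C C') X ↔ i ∈ sureZeros C' (X ∘ Sum.inr) := by
    intro i; simp only [mem_sureZeros, Sum.exists]; simp [blockMatrix]
  have h0 : undeterminedZeros (blockMatrix C C') X =
      (undeterminedZeros C (X ∘ Sum.inl)).disjSum (undeterminedZeros C' (X ∘ Sum.inr)) := by
    ext (i | i)
    · rw [Finset.inl_mem_disjSum]
      simp only [mem_undeterminedZeros, Sum.forall, hp, hp']
      simp [blockMatrix]
    · rw [Finset.inr_mem_disjSum]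
      simp only [mem_undeterminedZeros, Sum.forall, hp, hp']
      simp [blockMatrix]
  have h1 : undeterminedOnes (blockMatrix C C') X =
      (undeterminedOnes C (X ∘ Sum.inl)).disjSum (undeterminedOnes C' (X ∘ Sum.inr)) := by
    ext (i | i)
    · rw [Finset.inl_mem_disjSum]
      simp only [mem_undeterminedOnes, Sum.forall, Sum.exists, hz, hz']
      simp [blockMatrix]
    · rw [Finset.inr_mem_disjSum]
      simp only [mem_undeterminedOnes, Sum.forall, Sum.exists, hz, hz']
      simp [blockMatrix]
  simp only [numTests, h0, h1, Finset.card_disjSum, Fintype.card_sum]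
  ring

theorem meanTests_blockMatrix (C : ι → κ → Bool) (C' : ι' → κ' → Bool) (p : ℝ) :
    meanTests (blockMatrix C C') p = meanTests C p + meanTests C' p := by
  have hw : ∀ X : ι ⊕ ι' → Bool, bernoulliWeight p X =
      bernoulliWeight p (X ∘ Sum.inl) * bernoulliWeight p (X ∘ Sum.inr) := by
    intro X; simp [bernoulliWeight, Fintype.prod_sum_type]
  calc _ = ∑ Y : (ι → Bool) × (ι' → Bool), bernoulliWeight p Y.1 * bernoulliWeight p Y.2 *
        ((numTests C Y.1 : ℝ) + numTests C' Y.2) := by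
        unfold meanTests
        refine Fintype.sum_equiv (Equiv.sumArrowEquivProdArrow ι ι' Bool) _ _ fun X => ?_
        rw [hw, numTests_blockMatrix, Nat.cast_add]
        rfl
    _ = (∑ X, bernoulliWeight p X * (numTests C X : ℝ)) * (∑ X' : ι' → Bool, bernoulliWeight p X') +
        (∑ X : ι → Bool, bernoulliWeight p X) *
          ∑ X', bernoulliWeight p X' * (numTests C' X' : ℝ) := by
        rw [Finset.sum_mul_sum, Finset.sum_mul_sum, Fintype.sum_prod_type, ← Finset.sum_add_distrib]
        refine Finset.sum_congr rfl fun X _ => ?_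
        rw [← Finset.sum_add_distrib]
        refine Finset.sum_congr rfl fun X' _ => ?_
        ring
    _ = _ := by rw [sum_bernoulliWeight, sum_bernoulliWeight, mul_one, one_mul]; rfl

end DisjointUnion

theorem subadditive_optimalMeanTests (p : ℝ) : Subadditive fun N => optimalMeanTests N p := by
  intro m n
  rcases Nat.eq_zero_or_pos m with rfl | hm
  · simp [optimalMeanTests_zero]
  rcases Nat.eq_zero_or_pos n with rfl | hn
  · simp [optimalMeanTests_zero]
  obtain ⟨M, hM1, hM2, C, hC⟩ := (isLeast_optimalMeanTests hm p).1
  obtain ⟨M', hM1', hM2', C', hC'⟩ := (isLeast_optimalMeanTests hn p).1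
  have := optimalMeanTests_le (p := p) (blockMatrix C C') (by simp; omega) (by simp; omega)
  rw [meanTests_blockMatrix, ← hC, ← hC'] at this
  simpa using this

theorem bddBelow_optimalMeanTests_div {p : ℝ} (h0 : 0 ≤ p) (h1 : p ≤ 1) :
    BddBelow (Set.range fun N : ℕ => optimalMeanTests N p / N) := by
  refine ⟨0, ?_⟩
  rintro _ ⟨N, rfl⟩
  exact div_nonneg (optimalMeanTests_nonneg h0 h1 N) (Nat.cast_nonneg N)

/-! ### Random partitions into pools -/

section RandomPools

variable {ι : Type} [Fintype ι] [DecidableEq ι]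

/-- The number of defective items. -/
def defectives (X : ι → Bool) : Finset ι := Finset.univ.filter fun i => X i = true

/-- The connectivity matrix in which, for each `l`, the `m` pools `(l, ·)` partition the items
according to the value of `f l`. -/
def hashMatrix {L m : ℕ} (f : Fin L → ι → Fin m) (i : ι) (a : Fin L × Fin m) : Bool :=
  decide (f a.1 i = a.2)

theorem mem_undeterminedZeros_hashMatrix {L m : ℕ} {f : Fin L → ι → Fin m} {X : ι → Bool} {i : ι} :
    i ∈ undeterminedZeros (hashMatrix f) X ↔
      X i = false ∧ ∀ l, ∃ j, X j = true ∧ f l j = f l i := by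
  rw [mem_undeterminedZeros]
  refine and_congr_right fun _ => ?_
  simp only [hashMatrix, TestPositive, Prod.forall, decide_eq_true_eq]
  refine forall_congr' fun l => ⟨fun h => ?_, fun h b hb => ?_⟩
  · obtain ⟨j, hj, hX⟩ := h _ rfl
    exact ⟨j, hX, hj⟩
  · obtain ⟨j, hX, hj⟩ := h
    exact ⟨j, hj.trans hb, hX⟩

/-- Fix the pool `b` of `i`: each defective independently avoids `b` with probability `1 - 1 / m`,
and the other items are free. -/
theorem card_hash_isolated {m : ℕ} (hm : 1 ≤ m) {X : ι → Bool} {i : ι} (hi : X i = false) :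
    ((Finset.univ.filter fun g : ι → Fin m => ∀ j, X j = true → g j ≠ g i).card : ℝ) =
      (m : ℝ) ^ Fintype.card ι * (1 - 1 / m) ^ (defectives X).card := by
  have hm0 : (m : ℝ) ≠ 0 := by positivity
  have h : (Finset.univ.filter fun g : ι → Fin m => ∀ j, X j = true → g j ≠ g i).card =
      ∑ b : Fin m, (Fintype.piFinset fun j : ι =>
        if X j = true then Finset.univ.erase b else if j = i then {b} else Finset.univ).card := by
    rw [Finset.card_eq_sum_card_fiberwise (f := fun g => g i) (t := Finset.univ)
      (fun _ _ => Finset.mem_coe.2 (Finset.mem_univ _))]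
    refine Finset.sum_congr rfl fun b _ => ?_
    congr 1
    ext g
    simp only [Finset.mem_filter, Finset.mem_univ, true_and, Fintype.mem_piFinset]
    constructor
    · rintro ⟨h, rfl⟩ j
      split_ifs with h1 h2
      · simpa using h j h1
      · simp [h2]
      · simp
    · intro h
      have hgi : g i = b := by simpa [hi] using h i
      refine ⟨fun j hj => ?_, hgi⟩
      simpa [hj, hgi] using h j
  rw [h]
  simp only [Fintype.card_piFinset]
  push_cast
  have hprod : ∀ b : Fin m, ∏ j : ι, (((if X j = true then Finset.univ.erase b
      else if j = i then {b} else Finset.univ : Finset (Fin m)).card : ℕ) : ℝ) =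
      (m : ℝ) ^ Fintype.card ι * (1 - 1 / m) ^ (defectives X).card * (1 / m) := by
    intro b
    calc _ = ∏ j : ι, ((m : ℝ) * (if X j = true then (1 - 1 / (m : ℝ)) else 1) *
          if j = i then 1 / (m : ℝ) else 1) := by
          refine Finset.prod_congr rfl fun j _ => ?_
          by_cases hj : X j = true
          · have : j ≠ i := by rintro rfl; simp [hi] at hj
            simp [hj, this, Nat.cast_sub hm]
            field_simp
          · by_cases hji : j = i
            · subst hji; simp [hi]; field_simp
            · simp [hj, hji]
      _ = _ := by
          rw [Finset.prod_mul_distrib, Finset.prod_mul_distrib, Finset.prod_const, Finset.card_univ,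
            ← Finset.prod_filter, Finset.prod_const, Finset.prod_ite_eq' Finset.univ i]
          simp [defectives]
  rw [Finset.sum_congr rfl fun b _ => hprod b, Finset.sum_const, Finset.card_univ, Fintype.card_fin,
    nsmul_eq_mul]
  field_simp

theorem card_hash_contaminated {L m : ℕ} (hm : 1 ≤ m) {X : ι → Bool} {i : ι} (hi : X i = false) :
    ((Finset.univ.filter fun f : Fin L → ι → Fin m =>
        i ∈ undeterminedZeros (hashMatrix f) X).card : ℝ) =
      Fintype.card (Fin L → ι → Fin m) * (1 - (1 - 1 / (m : ℝ)) ^ (defectives X).card) ^ L := by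
  have h1 : (Finset.univ.filter fun f : Fin L → ι → Fin m =>
      i ∈ undeterminedZeros (hashMatrix f) X) = Fintype.piFinset fun _ : Fin L =>
        Finset.univ.filter fun g : ι → Fin m => ¬ ∀ j, X j = true → g j ≠ g i := by
    ext f
    simp [mem_undeterminedZeros_hashMatrix, hi]
  have h2 : ((Finset.univ.filter fun g : ι → Fin m => ¬ ∀ j, X j = true → g j ≠ g i).card : ℝ) =
      (m : ℝ) ^ Fintype.card ι * (1 - (1 - 1 / (m : ℝ)) ^ (defectives X).card) := by
    have := Finset.card_filter_add_card_filter_not (s := Finset.univ)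
      (fun g : ι → Fin m => ∀ j, X j = true → g j ≠ g i)
    have h3 : ((Finset.univ.filter fun g : ι → Fin m => ∀ j, X j = true → g j ≠ g i).card : ℝ) +
        (Finset.univ.filter fun g : ι → Fin m => ¬ ∀ j, X j = true → g j ≠ g i).card =
        (m : ℝ) ^ Fintype.card ι := by
      rw [← Nat.cast_add, this]
      simp
    rw [card_hash_isolated hm hi] at h3
    linarith
  rw [h1, Fintype.card_piFinset_const, Nat.cast_pow, h2, mul_pow]
  simp

theorem sum_card_undeterminedZeros_hashMatrix_le {L m : ℕ} (hm : 1 ≤ m) (X : ι → Bool) :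
    ∑ f : Fin L → ι → Fin m, ((undeterminedZeros (hashMatrix f) X).card : ℝ) ≤
      Fintype.card (Fin L → ι → Fin m) *
        (Fintype.card ι * (1 - (1 - 1 / (m : ℝ)) ^ (defectives X).card) ^ L) := by
  have hnn : 0 ≤ 1 - (1 - 1 / (m : ℝ)) ^ (defectives X).card := by
    have hm' : (1 : ℝ) ≤ m := by exact_mod_cast hm
    have : 1 / (m : ℝ) ≤ 1 := by rw [div_le_one (by linarith)]; exact hm'
    have h2 : 0 ≤ 1 / (m : ℝ) := by positivity
    linarith [pow_le_one₀ (n := (defectives X).card) (sub_nonneg.2 this) (by linarith)]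
  have h : ∀ f : Fin L → ι → Fin m, ((undeterminedZeros (hashMatrix f) X).card : ℝ) =
      ∑ i, if i ∈ undeterminedZeros (hashMatrix f) X then 1 else 0 := by
    intro f; simp
  simp only [h]
  rw [Finset.sum_comm, mul_left_comm, ← nsmul_eq_mul (Fintype.card ι), ← Finset.card_univ,
    ← Finset.sum_const]
  refine Finset.sum_le_sum fun i _ => ?_
  cases hi : X i
  · rw [← Finset.card_univ, Finset.card_univ, ← card_hash_contaminated hm hi]
    simp
  · simp only [mem_undeterminedZeros, hi]
    simp only [Bool.true_eq_false, false_and, if_false, Finset.sum_const_zero]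
    positivity

/-- Generating function of the binomial law, used at `t = 1 + d` for the Chernoff bound. -/
theorem sum_bernoulliWeight_mul_pow (p t : ℝ) :
    ∑ X : ι → Bool, bernoulliWeight p X * t ^ (defectives X).card =
      (1 + p * (t - 1)) ^ Fintype.card ι := by
  have h : ∀ X : ι → Bool, bernoulliWeight p X * t ^ (defectives X).card =
      ∏ i, if X i = true then p * t else 1 - p := by
    intro X
    rw [defectives, ← Finset.prod_const, Finset.prod_filter, bernoulliWeight,
      ← Finset.prod_mul_distrib]
    refine Finset.prod_congr rfl fun i _ => ?_
    split_ifs <;> ring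
  simp only [h]
  rw [sum_prod_bool (fun _ b => if b = true then p * t else 1 - p)]
  simp only [if_true, Bool.false_eq_true, if_false, Finset.prod_const, Finset.card_univ]
  congr 1
  ring

theorem sum_bernoulliWeight_mul_card_defectives (p : ℝ) :
    ∑ X : ι → Bool, bernoulliWeight p X * ((defectives X).card : ℝ) = Fintype.card ι * p := by
  rw [sum_bernoulliWeight_mul_card, ← nsmul_eq_mul, ← Finset.card_univ, ← Finset.sum_const]
  refine Finset.sum_congr rfl fun i _ => ?_
  have h : ∀ X : ι → Bool, (bernoulliWeight p X * if i ∈ defectives X then 1 else 0) =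
      ∏ j, if X j = true then p else if j = i then 0 else 1 - p := by
    intro X
    by_cases hX : X i = true
    · rw [if_pos (by simpa [defectives] using hX), mul_one]
      refine Finset.prod_congr rfl fun j _ => ?_
      by_cases hj : j = i
      · subst hj; simp [hX]
      · simp [hj]
    · rw [if_neg (by simpa [defectives] using hX), mul_zero, eq_comm]
      exact Finset.prod_eq_zero (Finset.mem_univ i) (by simp [hX])
  simp only [h]
  rw [sum_prod_bool (fun j b => if b = true then p else if j = i then 0 else 1 - p),
    Finset.prod_eq_single i]
  · simp
  · intro j _ hj; simp [hj]
  · simp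

theorem half_le_one_sub_pow {m k : ℕ} {a : ℝ} (hm : a ≤ Real.log 2 * (m - 1)) (ha : 0 < a)
    (hk : (k : ℝ) ≤ a) : 1 / 2 ≤ (1 - 1 / (m : ℝ)) ^ k := by
  have hl := Real.log_pos one_lt_two
  have hm1 : 0 < (m : ℝ) - 1 := by
    by_contra h
    push Not at h
    nlinarith
  have hm0 : (0 : ℝ) < m := by linarith
  have hpos : 0 < 1 - 1 / (m : ℝ) := by
    rw [sub_pos, div_lt_one hm0]; linarith
  rw [← Real.log_le_log_iff (by norm_num) (by positivity), Real.log_pow, one_div, Real.log_inv]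
  have hlog : -(1 / ((m : ℝ) - 1)) ≤ Real.log (1 - 1 / m) := by
    have := Real.one_sub_inv_le_log_of_pos hpos
    refine le_trans (le_of_eq ?_) this
    field_simp
    ring
  have h1 : (k : ℝ) / (m - 1) ≤ Real.log 2 := by
    rw [div_le_iff₀ hm1]; linarith
  have h2 := mul_le_mul_of_nonneg_left hlog (Nat.cast_nonneg k : (0 : ℝ) ≤ k)
  have h3 : (k : ℝ) * -(1 / (m - 1)) = -(k / (m - 1)) := by ring
  linarith

/-- For `k ≤ a` defectives each partition contaminates with probability at most `1 / 2`. For `k > a`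
the trivial bound `1` lies below the exponential weight, as in Markov's inequality. -/
theorem pow_contaminated_le {L m k : ℕ} {a p d : ℝ} (hm : a ≤ Real.log 2 * (m - 1)) (ha : 0 < a)
    (hm1 : 1 ≤ m) (hL : (1 / 2 : ℝ) ^ L ≤ p) (hp : 0 ≤ p) (hd : 0 < d) :
    (1 - (1 - 1 / (m : ℝ)) ^ k) ^ L ≤ p + (1 + d) ^ k * Real.exp (-(a * Real.log (1 + d))) := by
  have hm' : (1 : ℝ) ≤ m := by exact_mod_cast hm1
  have h1 : 0 ≤ 1 - 1 / (m : ℝ) := by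
    rw [sub_nonneg, div_le_one (by linarith)]; exact hm'
  have h2 : 1 - 1 / (m : ℝ) ≤ 1 := by
    have : 0 ≤ 1 / (m : ℝ) := by positivity
    linarith
  have h3 := pow_le_one₀ (n := k) h1 h2
  have h4 := pow_nonneg h1 k
  rcases le_or_gt (k : ℝ) a with hk | hk
  · have := half_le_one_sub_pow hm ha hk
    have h5 : (1 - (1 - 1 / (m : ℝ)) ^ k) ^ L ≤ (1 / 2) ^ L :=
      pow_le_pow_left₀ (by linarith) (by linarith) L
    have h6 : 0 ≤ (1 + d) ^ k * Real.exp (-(a * Real.log (1 + d))) := by positivity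
    linarith
  · have h5 : (1 - (1 - 1 / (m : ℝ)) ^ k) ^ L ≤ 1 := pow_le_one₀ (by linarith) (by linarith)
    have h6 : 1 ≤ (1 + d) ^ k * Real.exp (-(a * Real.log (1 + d))) := by
      have hd1 : 0 < 1 + d := by linarith
      rw [← Real.exp_log (pow_pos hd1 k), Real.log_pow, ← Real.exp_add]
      refine Real.one_le_exp ?_
      have := Real.log_nonneg (show 1 ≤ 1 + d by linarith)
      nlinarith
    linarith

theorem card_undeterminedOnes_le {κ : Type} [Fintype κ] (C : ι → κ → Bool) (X : ι → Bool) :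
    (undeterminedOnes C X).card ≤ (defectives X).card :=
  Finset.card_le_card Finset.sdiff_subset

/-- Some choice of the hash functions performs at least as well as the average. -/
theorem exists_meanTests_hashMatrix_le {L m : ℕ} (hm1 : 1 ≤ m) {a p d : ℝ} (h0 : 0 < p)
    (h1 : p < 1) (hm : a ≤ Real.log 2 * (m - 1)) (ha : 0 < a) (hL : (1 / 2 : ℝ) ^ L ≤ p)
    (hd : 0 < d) :
    ∃ f : Fin L → ι → Fin m, meanTests (hashMatrix f) p ≤ L * m + 2 * (Fintype.card ι * p) +
      Fintype.card ι * Real.exp (Fintype.card ι * p * d - a * Real.log (1 + d)) := by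
  have : Nonempty (Fin m) := ⟨⟨0, hm1⟩⟩
  set n : ℝ := ((Fintype.card ι : ℕ) : ℝ) with hn
  set F : ℝ := ((Fintype.card (Fin L → ι → Fin m) : ℕ) : ℝ) with hF
  have hU0 : ∑ f : Fin L → ι → Fin m,
      ∑ X, bernoulliWeight p X * ((undeterminedZeros (hashMatrix f) X).card : ℝ) ≤
      F * (n * p + n * Real.exp (n * p * d - a * Real.log (1 + d))) := by
    calc _ = ∑ X : ι → Bool, bernoulliWeight p X *
          ∑ f : Fin L → ι → Fin m, ((undeterminedZeros (hashMatrix f) X).card : ℝ) := by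
          rw [Finset.sum_comm]; simp only [Finset.mul_sum]
      _ ≤ ∑ X : ι → Bool, bernoulliWeight p X * (F * (n * (p +
            (1 + d) ^ (defectives X).card * Real.exp (-(a * Real.log (1 + d)))))) := by
          refine Finset.sum_le_sum fun X _ => mul_le_mul_of_nonneg_left
            ((sum_card_undeterminedZeros_hashMatrix_le hm1 X).trans ?_)
            (bernoulliWeight_nonneg h0.le h1.le X)
          have := pow_contaminated_le (k := (defectives X).card) hm ha hm1 hL h0.le hd
          gcongr
      _ = F * (n * p * (∑ X : ι → Bool, bernoulliWeight p X) +
            n * Real.exp (-(a * Real.log (1 + d))) *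
              ∑ X : ι → Bool, bernoulliWeight p X * (1 + d) ^ (defectives X).card) := by
          rw [Finset.mul_sum, Finset.mul_sum, ← Finset.sum_add_distrib, Finset.mul_sum]
          refine Finset.sum_congr rfl fun X _ => ?_
          ring
      _ ≤ _ := by
          rw [sum_bernoulliWeight, sum_bernoulliWeight_mul_pow, mul_one, add_sub_cancel_left,
            sub_eq_add_neg (n * p * d), Real.exp_add, mul_assoc n, mul_comm (Real.exp (n * p * d))]
          have : (1 + p * d) ^ Fintype.card ι ≤ Real.exp (n * p * d) := by
            rw [mul_assoc, Real.exp_nat_mul]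
            refine pow_le_pow_left₀ (by positivity) ?_ _
            linarith [Real.add_one_le_exp (p * d)]
          gcongr
  -- Retesting every defective costs only `n * p`, a lower order than `n * p * |log p|`.
  have hU1 : ∀ f : Fin L → ι → Fin m,
      ∑ X, bernoulliWeight p X * ((undeterminedOnes (hashMatrix f) X).card : ℝ) ≤ n * p := by
    intro f
    rw [← sum_bernoulliWeight_mul_card_defectives]
    refine Finset.sum_le_sum fun X _ => mul_le_mul_of_nonneg_left ?_
      (bernoulliWeight_nonneg h0.le h1.le X)
    exact_mod_cast card_undeterminedOnes_le _ _
  have hsum : ∑ f : Fin L → ι → Fin m, meanTests (hashMatrix f) p ≤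
      ∑ _f : Fin L → ι → Fin m,
        (L * m + 2 * (n * p) + n * Real.exp (n * p * d - a * Real.log (1 + d))) := by
    rw [Finset.sum_const, Finset.card_univ, nsmul_eq_mul]
    calc _ ≤ ∑ f : Fin L → ι → Fin m, (((L : ℝ) * m + n * p) +
          ∑ X, bernoulliWeight p X * ((undeterminedZeros (hashMatrix f) X).card : ℝ)) := by
          refine Finset.sum_le_sum fun f _ => ?_
          rw [meanTests_eq]
          have := hU1 f
          simp only [Fintype.card_prod, Fintype.card_fin]
          push_cast
          linarith
      _ ≤ _ := by
          rw [Finset.sum_add_distrib, Finset.sum_const, Finset.card_univ, nsmul_eq_mul]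
          linarith
  obtain ⟨f, -, hf⟩ := Finset.exists_le_of_sum_le Finset.univ_nonempty hsum
  exact ⟨f, hf⟩

end RandomPools

/-! ### Choice of parameters in the upper bound -/

theorem optimalMeanTests_le_hash {L m N : ℕ} (hm1 : 1 ≤ m) {a p d : ℝ} (h0 : 0 < p)
    (h1 : p < 1) (hm : a ≤ Real.log 2 * (m - 1)) (ha : 0 < a) (hL : (1 / 2 : ℝ) ^ L ≤ p)
    (hd : 0 < d) :
    optimalMeanTests N p ≤
      L * m + 2 * (N * p) + N * Real.exp (N * p * d - a * Real.log (1 + d)) := by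
  rcases le_or_gt (L * m) N with h | h
  · obtain ⟨f, hf⟩ := exists_meanTests_hashMatrix_le (ι := Fin N) hm1 h0 h1 hm ha hL hd
    have hL1 : 1 ≤ L := by
      rcases Nat.eq_zero_or_pos L with rfl | hL0
      · rw [pow_zero] at hL; linarith
      · exact hL0
    have := optimalMeanTests_le (p := p) (hashMatrix f) 
      (by rw [Fintype.card_prod, Fintype.card_fin, Fintype.card_fin]; exact Nat.mul_pos hL1 hm1)
      (by simpa using h)
    simp only [Fintype.card_fin] at this hf
    exact this.trans hf
  -- With more than `N` pools the scheme is inadmissible, but individual testing is already cheaper.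
  · have h2 : (N : ℝ) ≤ L * m := by exact_mod_cast h.le
    have h3 : 0 ≤ 2 * (N * p) + N * Real.exp (N * p * d - a * Real.log (1 + d)) := by positivity
    linarith [optimalMeanTests_le_self N p]

/-- The Chernoff rate for exceeding the mean by a factor `1 + d`. -/
theorem lt_one_add_mul_log_one_add {d : ℝ} (hd : 0 < d) : 0 < (1 + d) * Real.log (1 + d) - d := by
  have h1 : 0 < 1 + d := by linarith
  have h := Real.log_lt_sub_one_of_pos (inv_pos.2 h1) (by
    rw [ne_eq, inv_eq_one]; linarith)
  rw [Real.log_inv] at h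
  have h2 := mul_lt_mul_of_pos_left h h1
  rw [mul_sub, mul_inv_cancel₀ h1.ne'] at h2
  linarith

theorem exists_optimalMeanTests_le {d : ℝ} (hd : 0 < d) :
    ∃ B : ℝ, ∀ p : ℝ, 0 < p → p < 1 → ∀ N : ℕ, 1 ≤ N * p ^ 2 →
      optimalMeanTests N p ≤
        (1 + d) / Real.log 2 ^ 2 * (N * p * |Real.log p|) + B * (N * p) := by
  have hl := Real.log_pos one_lt_two
  set c := (1 + d) * Real.log (1 + d) - d with hc
  have hcpos : 0 < c := lt_one_add_mul_log_one_add hd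
  -- The first two terms come from rounding up `L` and `m`, together with the extra pool; `4` is the
  -- `2 * (N * p)` term plus the constant `2 ≤ 2 * y`; `1 / c` is the tail.
  refine ⟨(1 + d) / Real.log 2 + 2 / Real.log 2 + 4 + 1 / c, fun p h0 h1 N hN => ?_⟩
  have hlog := Real.log_neg h0 h1
  rw [abs_of_neg hlog]
  set q := -Real.log p with hq
  have hqpos : 0 < q := by linarith
  set y := (N : ℝ) * p with hy
  have hyp : 1 / p ≤ y := by
    rw [div_le_iff₀ h0]; nlinarith
  have hqp : q ≤ 1 / p := by
    have := Real.log_le_sub_one_of_pos (inv_pos.2 h0)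
    rw [Real.log_inv] at this
    rw [one_div]; linarith
  have hp1 : 1 ≤ 1 / p := by rw [le_div_iff₀ h0]; linarith
  have hypos : 0 < y := by linarith
  set a := (1 + d) * y with ha
  have hapos : 0 < a := by positivity
  have hm := Nat.le_ceil (a / Real.log 2)
  have hm' := Nat.ceil_lt_add_one (a := a / Real.log 2) (by positivity)
  have hL := Nat.le_ceil (q / Real.log 2)
  have hL' := Nat.ceil_lt_add_one (a := q / Real.log 2) (by positivity)
  set m := ⌈a / Real.log 2⌉₊
  set L := ⌈q / Real.log 2⌉₊
  have hT := optimalMeanTests_le_hash (N := N) (L := L) (m := m + 1) (a := a) (by omega) h0 h1 (by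
      rw [div_le_iff₀ hl] at hm
      push_cast
      linarith) hapos (by
      rw [← Real.log_le_log_iff (by positivity) h0, Real.log_pow, one_div, Real.log_inv]
      rw [div_le_iff₀ hl] at hL
      linarith) hd
  -- The tail is `N * exp (-c y) ≤ N / (c y) = 1 / (c p)`, and `1 / p ≤ y` is the assumption `N p^2
  -- ≥ 1`.
  have hexp : (N : ℝ) * Real.exp (N * p * d - a * Real.log (1 + d)) ≤ 1 / c * y := by
    have e : (N : ℝ) * p * d - a * Real.log (1 + d) = -(y * c) := by
      rw [ha, hc, ← hy]; ring
    rw [e, Real.exp_neg]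
    have h2 : y * c ≤ Real.exp (y * c) := by linarith [Real.add_one_le_exp (y * c)]
    have h3 : (Real.exp (y * c))⁻¹ ≤ (y * c)⁻¹ := inv_anti₀ (by positivity) h2
    have hN0 : (N : ℝ) ≠ 0 := by rintro h; simp [hy, h] at hypos
    calc _ ≤ (N : ℝ) * (y * c)⁻¹ := by gcongr
      _ = 1 / c * (1 / p) := by rw [hy]; field_simp
      _ ≤ _ := by gcongr
  have hprod : (L : ℝ) * (m + 1) ≤ (q / Real.log 2 + 1) * (a / Real.log 2 + 2) :=
    mul_le_mul hL'.le (by linarith) (by positivity) (by positivity)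
  have hexpand : (q / Real.log 2 + 1) * (a / Real.log 2 + 2) =
      (1 + d) / Real.log 2 ^ 2 * (y * q) + (1 + d) / Real.log 2 * y + 2 / Real.log 2 * q + 2 := by
    rw [ha]; field_simp; ring
  have h5 : 2 / Real.log 2 * q ≤ 2 / Real.log 2 * y := by
    gcongr; linarith
  push_cast at hT
  linarith

/-! ### The two limits -/

theorem tendsto_abs_log_nhdsGT_zero : Tendsto (fun p : ℝ => |Real.log p|) (𝓝[>] 0) atTop :=
  tendsto_abs_atBot_atTop.comp Real.tendsto_log_nhdsGT_zero

theorem eventually_optimalMeanTests_div_lt {u : ℝ} (hu : 1 / Real.log 2 ^ 2 < u) :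
    ∀ᶠ p : ℝ in 𝓝[>] 0, ∀ N : ℕ, 1 ≤ N * p ^ 2 →
      optimalMeanTests N p / (N * p * |Real.log p|) < u := by
  have hl : 0 < Real.log 2 ^ 2 := by have := Real.log_pos one_lt_two; positivity
  obtain ⟨d, hd, hdu⟩ : ∃ d : ℝ, 0 < d ∧ (1 + d) / Real.log 2 ^ 2 < u := by
    refine ⟨(u * Real.log 2 ^ 2 - 1) / 2, ?_, ?_⟩
    · rw [div_lt_iff₀ hl] at hu; linarith
    · rw [div_lt_iff₀ hl] at hu ⊢; linarith
  obtain ⟨B, hB⟩ := exists_optimalMeanTests_le hd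
  have hlim : Tendsto (fun p => (1 + d) / Real.log 2 ^ 2 + B / |Real.log p|) (𝓝[>] 0)
      (𝓝 ((1 + d) / Real.log 2 ^ 2 + 0)) :=
    tendsto_const_nhds.add (tendsto_abs_log_nhdsGT_zero.const_div_atTop B)
  rw [add_zero] at hlim
  filter_upwards [hlim.eventually_lt_const hdu, Ioo_mem_nhdsGT (zero_lt_one' ℝ)] with p hpu hp N hN
  have hq : 0 < |Real.log p| := abs_pos.2 (Real.log_neg hp.1 hp.2).ne
  have hN0 : (0 : ℝ) < N := by
    by_contra h
    have := mul_nonpos_of_nonpos_of_nonneg (not_lt.1 h) (sq_nonneg p)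
    linarith
  have hp0 := hp.1
  have hpos : 0 < N * p * |Real.log p| := by positivity
  rw [div_lt_iff₀ hpos]
  calc _ ≤ _ := hB p hp.1 hp.2 N hN
    _ = ((1 + d) / Real.log 2 ^ 2 + B / |Real.log p|) * (N * p * |Real.log p|) := by
        field_simp
    _ < _ := mul_lt_mul_of_pos_right hpu hpos

theorem testRate_div_le {p : ℝ} (h0 : 0 < p) (h1 : p < 1) {N : ℕ} (hN : 1 ≤ N) :
    testRate p / (p * |Real.log p|) ≤ optimalMeanTests N p / (N * p * |Real.log p|) := by
  have hq : 0 < |Real.log p| := abs_pos.2 (Real.log_neg h0 h1).ne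
  have hN0 : (0 : ℝ) < N := by exact_mod_cast hN
  rw [div_le_div_iff₀ (by positivity) (by positivity)]
  have := mul_le_mul_of_nonneg_right (mul_testRate_le_optimalMeanTests h0 h1 hN)
    (show 0 ≤ p * |Real.log p| by positivity)
  linarith

theorem tendsto_optimalMeanTests_rpow {β : ℝ} (h0 : 0 < β) (h1 : β < 1 / 2) :
    Tendsto
      (fun N : ℕ => optimalMeanTests N ((N : ℝ) ^ (-β)) /
        ((N : ℝ) * (N : ℝ) ^ (-β) * |Real.log ((N : ℝ) ^ (-β))|))
      atTop (𝓝 (1 / Real.log 2 ^ 2)) := by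
  have hp : Tendsto (fun N : ℕ => (N : ℝ) ^ (-β)) atTop (𝓝[>] 0) := by
    refine tendsto_nhdsWithin_iff.2
      ⟨(tendsto_rpow_neg_atTop h0).comp tendsto_natCast_atTop_atTop, ?_⟩
    filter_upwards [eventually_ge_atTop 1] with N hN
    exact Real.rpow_pos_of_pos (by exact_mod_cast hN) _
  refine tendsto_order.2 ⟨fun l hl => ?_, fun u hu => ?_⟩
  · filter_upwards [(tendsto_testRate_div.comp hp).eventually_const_lt hl,
      hp.eventually (Ioo_mem_nhdsGT (zero_lt_one' ℝ)), eventually_ge_atTop 1] with N h hN hN1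
    exact h.trans_le (testRate_div_le hN.1 hN.2 hN1)
  · filter_upwards [hp.eventually (eventually_optimalMeanTests_div_lt hu),
      eventually_ge_atTop 1] with N h hN1
    refine h N ?_
    have hN1' : (1 : ℝ) ≤ N := by exact_mod_cast hN1
    have hN0 : (0 : ℝ) < N := by linarith
    -- Here `N p^2 = N^(1 - 2β)`, at least `1` because `β < 1/2`.
    rw [← Real.rpow_natCast, ← Real.rpow_mul hN0.le, ← Real.rpow_one_add' hN0.le]
    · exact Real.one_le_rpow hN1' (by push_cast; linarith)
    · push_cast; linarith

/-- The limit of the optimal mean number of tests, divided by its order of magnitude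
`N * p * |log p|`, as the number of items tends to infinity. -/
noncomputable def limitRatio (p : ℝ) : ℝ :=
  (subadditive_optimalMeanTests p).lim / (p * |Real.log p|)

/-- Fekete's lemma, applied to the subadditive optimum. -/
theorem tendsto_limitRatio {p : ℝ} (h0 : 0 < p) (h1 : p < 1) :
    Tendsto (fun N : ℕ => optimalMeanTests N p / ((N : ℝ) * p * |Real.log p|)) atTop
      (𝓝 (limitRatio p)) := by
  refine (((subadditive_optimalMeanTests p).tendsto_lim
    (bddBelow_optimalMeanTests_div h0.le h1.le)).div_const (p * |Real.log p|)).congr fun N => ?_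
  rw [div_div, mul_assoc]

theorem tendsto_limitRatio_nhdsGT_zero :
    Tendsto limitRatio (𝓝[>] 0) (𝓝 (1 / Real.log 2 ^ 2)) := by
  refine tendsto_order.2 ⟨fun l hl => ?_, fun u hu => ?_⟩
  · filter_upwards [tendsto_testRate_div.eventually_const_lt hl,
      Ioo_mem_nhdsGT (zero_lt_one' ℝ)] with p h hp
    refine h.trans_le (ge_of_tendsto (tendsto_limitRatio hp.1 hp.2) ?_)
    filter_upwards [eventually_ge_atTop 1] with N hN using testRate_div_le hp.1 hp.2 hN
  -- Passing to the limit in `N` keeps only `≤ v`, so room is left below `u`. For fixed `p`, `N p^2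
  -- ≥ 1` holds eventually.
  · obtain ⟨v, hv, hvu⟩ := exists_between hu
    filter_upwards [eventually_optimalMeanTests_div_lt hv,
      Ioo_mem_nhdsGT (zero_lt_one' ℝ)] with p h hp
    refine (le_of_tendsto (tendsto_limitRatio hp.1 hp.2) ?_).trans_lt hvu
    have hp2 : 0 < p ^ 2 := pow_pos hp.1 2
    filter_upwards [(tendsto_natCast_atTop_atTop.atTop_mul_const hp2).eventually_ge_atTop 1]
      with N hN using (h N hN).le

end GroupTesting

theorem theorem1 :
    (∀ β : ℝ, 0 < β → β < 1 / 2 →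
      Tendsto
        (fun N : ℕ => GroupTesting.optimalMeanTests N ((N : ℝ) ^ (-β)) /
          ((N : ℝ) * (N : ℝ) ^ (-β) * |Real.log ((N : ℝ) ^ (-β))|))
        atTop (𝓝 (1 / Real.log 2 ^ 2))) ∧
    (∃ F : ℝ → ℝ,
      (∀ p : ℝ, 0 < p → p < 1 →
        Tendsto
          (fun N : ℕ => GroupTesting.optimalMeanTests N p / ((N : ℝ) * p * |Real.log p|))
          atTop (𝓝 (F p))) ∧
      Tendsto F (𝓝[>] (0 : ℝ)) (𝓝 (1 / Real.log 2 ^ 2))) :=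
  ⟨fun _ h0 h1 => GroupTesting.tendsto_optimalMeanTests_rpow h0 h1, GroupTesting.limitRatio,
    fun _ h0 h1 => GroupTesting.tendsto_limitRatio h0 h1,
    GroupTesting.tendsto_limitRatio_nhdsGT_zero⟩
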